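/- Let $n\ge 1$, let $\Omega\subset\mathbb R^n$ be a bounded domain with $C^2$ boundary, and let $M\in C^2([0,\infty))$ be real-valued. Consider the heat equation with memory $$\partial_t y-\Delta y+\int_0^t M(t-s)\,y(s,x)\,ds=0 \ \text{ in } (0,\infty)\times\Omega,\qquad y=0 \ \text{ on } (0,\infty)\times\partial\Omega,\qquad y(0,\cdot)=y_0\in L^2(\Omega),$$ and denote by $y(\cdot;y_0)\in C([0,\infty);L^2(\Omega))$ its unique (weak) solution, that is, $\frac{d}{dt}\langle y(t),\varphi\rangle_{L^2(\Omega)}=\langle y(t),A\varphi\rangle_{L^2(\Omega)}-\int_0^t M(t-s)\langle y(s),\varphi\rangle_{L^2(\Omega)}\,ds$ for all $t>0$ and $\varphi\in D(A)$, and $y(0)=y_0$. Here $A$ is the Dirichlet Laplacian on $L^2(\Omega)$: $Af=\Delta f$, $D(A)=\{f\in H_0^1(\Omega):\Delta f\in L^2(\Omega)\}=H^2(\Omega)\cap H_0^1(\Omega)$. Let $(\lambda_k)_{k\ge1}$ be an enumeration (repetitions allowed) of the eigenvalues of $-A$, let $x_k$ be the solution of $$x'(t)+\lambda_k x(t)+\int_0^t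 M(t-s)\,x(s)\,ds=0\quad(t>0),\qquad x(0)=1,$$ and let $\mathcal N_k=\{t\in(0,\infty): x_k(t)=0\}$. Let $t_0>0$ and suppose that $\bigcup_{k\ge1}\mathcal N_k\neq(0,\infty)$. Then the following are equivalent: (i) the equation has backward uniqueness at $\{t_0\}$, that is, for every $y_0\in L^2(\Omega)$, $y(t_0;y_0)=0$ in $L^2(\Omega)$ implies $y_0=0$ in $L^2(\Omega)$; (ii) $t_0\in(0,\infty)\setminus\bigcup_{k\ge1}\mathcal N_k$. -/

import Mathlib

open Set Filter Topology MeasureTheory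
open scoped Distributions RealInnerProductSpace Laplacian

noncomputable section

namespace HeatMemory

/-- The boundary of the open set `Ω` is of class `C²`: near each boundary point, `Ω` is the
sublevel set `{ρ < 0}` of a `C²` function `ρ` whose differential does not vanish at that point. -/
def HasC2Boundary {n : ℕ} (Ω : TopologicalSpace.Opens (EuclideanSpace ℝ (Fin n))) : Prop :=
  ∀ p ∈ frontier (Ω : Set (EuclideanSpace ℝ (Fin n))),
    ∃ (U : Set (EuclideanSpace ℝ (Fin n))) (ρ : EuclideanSpace ℝ (Fin n) → ℝ),
      IsOpen U ∧ p ∈ U ∧ ContDiffOn ℝ 2 ρ U ∧ fderiv ℝ ρ p ≠ 0 ∧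
        ∀ z ∈ U, z ∈ Ω ↔ ρ z < 0

/-- The real Hilbert space `L²(Ω)`. -/
abbrev L2 {n : ℕ} (Ω : TopologicalSpace.Opens (EuclideanSpace ℝ (Fin n))) : Type :=
  Lp ℝ 2 ((volume : Measure (EuclideanSpace ℝ (Fin n))).restrict
    (Ω : Set (EuclideanSpace ℝ (Fin n))))

/-- `f ∈ H₀¹(Ω)`, the closure of `C_c^∞(Ω)` in the norm of `H¹(Ω)`: there are test functions
`φ j` with `φ j → f` in `L²(Ω)` and `∂ᵢ (φ j) → G i` in `L²(Ω)` for every `i`.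
(Then `G` is the weak gradient of `f`.) -/
def MemH10 {n : ℕ} (Ω : TopologicalSpace.Opens (EuclideanSpace ℝ (Fin n))) (f : L2 Ω) : Prop :=
  ∃ (G : Fin n → L2 Ω) (φ : ℕ → 𝓓(Ω, ℝ)),
    Tendsto (fun j => eLpNorm (fun z => φ j z - f z) 2
      ((volume : Measure (EuclideanSpace ℝ (Fin n))).restrict Ω)) atTop (𝓝 0) ∧
    ∀ i : Fin n,
      Tendsto (fun j => eLpNorm
        (fun z => fderiv ℝ (φ j) z (EuclideanSpace.single i (1 : ℝ)) - G i z) 2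
        ((volume : Measure (EuclideanSpace ℝ (Fin n))).restrict Ω)) atTop (𝓝 0)

/-- `Δ f = g` in `Ω` in the sense of distributions, for `f, g ∈ L²(Ω)`. -/
def HasWeakLaplacian {n : ℕ} (Ω : TopologicalSpace.Opens (EuclideanSpace ℝ (Fin n)))
    (f g : L2 Ω) : Prop :=
  ∀ φ : 𝓓(Ω, ℝ),
    ∫ z in (Ω : Set (EuclideanSpace ℝ (Fin n))), f z * (Δ (φ : EuclideanSpace ℝ (Fin n) → ℝ)) z =
      ∫ z in (Ω : Set (EuclideanSpace ℝ (Fin n))), g z * φ z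

/-- The graph of the Dirichlet Laplacian `A` on `L²(Ω)`: `f ∈ D(A)` and `A f = g`. Here
`D(A) = {f ∈ H₀¹(Ω) : Δ f ∈ L²(Ω)}`, which is `H²(Ω) ∩ H₀¹(Ω)` when `Ω` is bounded with
`C²` boundary. -/
def DirichletLaplacian {n : ℕ} (Ω : TopologicalSpace.Opens (EuclideanSpace ℝ (Fin n)))
    (f g : L2 Ω) : Prop :=
  MemH10 Ω f ∧ HasWeakLaplacian Ω f g

/-- The set of eigenvalues of `-A`. -/
def dirichletEigenvalues {n : ℕ} (Ω : TopologicalSpace.Opens (EuclideanSpace ℝ (Fin n))) :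
    Set ℝ :=
  {μ | ∃ f : L2 Ω, f ≠ 0 ∧ DirichletLaplacian Ω f (-(μ • f))}

/-- `y ∈ C([0,∞); L²(Ω))` is the (weak) solution of
`∂ₜ y - Δ y + ∫₀ᵗ M(t-s) y(s) ds = 0` with homogeneous Dirichlet condition and `y(0) = y₀`:
for all `φ ∈ D(A)` and `t > 0`,
`d/dt ⟪y(t), φ⟫ = ⟪y(t), A φ⟫ - ∫₀ᵗ M(t-s) ⟪y(s), φ⟫ ds`.
Since `A` is self-adjoint, testing against all of `D(A)` (not only against `C_c^∞(Ω)`) is what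
encodes the boundary condition, and these are the mild solutions for the semigroup of `A`. -/
def IsSolution {n : ℕ} (Ω : TopologicalSpace.Opens (EuclideanSpace ℝ (Fin n))) (M : ℝ → ℝ)
    (y₀ : L2 Ω) (y : ℝ → L2 Ω) : Prop :=
  ContinuousOn y (Ici 0) ∧ y 0 = y₀ ∧
    ∀ φ Aφ : L2 Ω, DirichletLaplacian Ω φ Aφ → ∀ t : ℝ, 0 < t →
      HasDerivAt (fun τ => ⟪y τ, φ⟫) (⟪y t, Aφ⟫ - ∫ s in (0 : ℝ)..t, M (t - s) * ⟪y s, φ⟫) t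

/-- Backward uniqueness at the time instants `t₁, …, t_m`: if the solution with initial datum
`y₀ ∈ L²(Ω)` vanishes at all of them, then `y₀ = 0`. -/
def BackwardUniquenessAt {n : ℕ} (Ω : TopologicalSpace.Opens (EuclideanSpace ℝ (Fin n)))
    (M : ℝ → ℝ) {m : ℕ} (t : Fin m → ℝ) : Prop :=
  ∀ (y₀ : L2 Ω) (y : ℝ → L2 Ω), IsSolution Ω M y₀ y → (∀ j, y (t j) = 0) → y₀ = 0

/-- `x` is the solution on `[0,∞)` of
`x'(t) + μ x(t) + ∫₀ᵗ M(t-s) x(s) ds = 0` for `t > 0`, `x(0) = 1`. -/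
def IsModeSolution (M : ℝ → ℝ) (μ : ℝ) (x : ℝ → ℝ) : Prop :=
  ContinuousOn x (Ici 0) ∧ x 0 = 1 ∧
    ∀ t : ℝ, 0 < t → HasDerivAt x (-(μ * x t) - ∫ s in (0 : ℝ)..t, M (t - s) * x s) t

/-- The set of zeros of `x` in `(0,∞)`. -/
def positiveZeros (x : ℝ → ℝ) : Set ℝ := {t | 0 < t ∧ x t = 0}

end HeatMemory

end

/-!
The equation is diagonal in the eigenfunctions of the Dirichlet Laplacian. If `A f = -μ f`, the
coefficient `⟪y t, f⟫` of a solution satisfies the scalar equation with parameter `μ`, hence equals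
`⟪y 0, f⟫ * x t` with `x` the normalised solution (`IsSolution.inner_eigenfunction_eq`, from the
uniqueness theorem `eq_zero_of_volterra`). When no `x k` vanishes at `t₀`, a solution with
`y t₀ = 0` has an initial value orthogonal to all eigenfunctions, which is `0` because the
eigenfunctions are complete. Conversely, if `x k t₀ = 0`, then `t ↦ x k t • f` with `f` an
eigenfunction for `lam k` is a solution (`isSolution_smul_eigenfunction`, where the symmetry of `A`
is used) that vanishes at `t₀` but not at `0`.

Completeness (`eq_zero_of_forall_inner_eigenfunction`) is the spectral theorem for the operator
`(1 - A)⁻¹ = J J†`, where `J : H₀¹(Ω) → L²(Ω)` is the inclusion: this operator is symmetric,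
injective since test functions are dense, and compact by Rellich's theorem
(`isCompactOperator_inclusionH10`).

Rellich's theorem is proved by averaging. Partition `Ω` into finitely many pieces, each within
distance `r` of a centre `a`, and replace `φ` on each piece by its mean over `B(a, r)`. This is an
operator of finite rank, and since `B(a, r) ⊆ B(x, 2r)` for `x` in the piece, Jensen's inequality
bounds the square of the `L²` error by `2ⁿ` times an average over `|z| < 2r` of the squared
translation differences `‖φ(· + z) - φ‖²`, which are at most `|z|² ‖∇φ‖²`. So `J` is a norm limit
of compact operators.
-/

namespace HeatMemory

/-! ### The scalar equation with memory -/

/-- Uniqueness for the scalar equation with memory: with `g t = ∫₀ᵗ |w|`, the energy `w² + g²` obeys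
a linear differential inequality, hence vanishes by Grönwall's argument. -/
theorem eq_zero_of_volterra {M w : ℝ → ℝ} {μ : ℝ} (hM : ContinuousOn M (Ici 0))
    (hw : ContinuousOn w (Ici 0)) (h0 : w 0 = 0)
    (hd : ∀ t : ℝ, 0 < t →
      HasDerivAt w (-(μ * w t) - ∫ s in (0 : ℝ)..t, M (t - s) * w s) t)
    {T : ℝ} (hT : 0 < T) : w T = 0 := by
  obtain ⟨C, hC⟩ := isCompact_Icc.exists_bound_of_continuousOn
    (hM.mono (fun s (hs : s ∈ Icc 0 T) => hs.1))
  have hC0 : 0 ≤ C := (norm_nonneg _).trans (hC 0 ⟨le_rfl, hT.le⟩)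
  have hint : ∀ t, 0 ≤ t → IntervalIntegrable (fun s => |w s|) volume 0 t := fun t ht =>
    (hw.abs.mono (by rw [uIcc_of_le ht]; exact Icc_subset_Ici_self)).intervalIntegrable
  have hgd : ∀ t, 0 < t → HasDerivAt (fun t => ∫ s in (0 : ℝ)..t, |w s|) |w t| t := by
    intro t ht
    refine intervalIntegral.integral_hasDerivAt_right (hint t ht.le) ?_
      (hw.abs.continuousAt (Ici_mem_nhds ht))
    exact (hw.abs.mono Ioi_subset_Ici_self).stronglyMeasurableAtFilter isOpen_Ioi t ht
  have hgc : ContinuousOn (fun t => ∫ s in (0 : ℝ)..t, |w s|) (Icc 0 T) := by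
    have := intervalIntegral.continuousOn_primitive_interval' (hint T hT.le)
      (left_mem_uIcc (a := (0 : ℝ)) (b := T))
    rwa [uIcc_of_le hT.le] at this
  have hker : ∀ t, 0 < t → t ≤ T →
      |∫ s in (0 : ℝ)..t, M (t - s) * w s| ≤ C * ∫ s in (0 : ℝ)..t, |w s| := by
    intro t ht htT
    rw [← intervalIntegral.integral_const_mul, ← Real.norm_eq_abs]
    refine intervalIntegral.norm_integral_le_of_norm_le ht.le (Eventually.of_forall ?_)
      ((hint t ht.le).const_mul C)
    intro s hs
    rw [norm_mul]
    exact mul_le_mul_of_nonneg_right (hC _ ⟨by linarith [hs.2], by linarith [hs.1]⟩)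
      (norm_nonneg _)
  -- With this rate `K`, the function `(w² + g²) exp (-K t)` is nonincreasing, and it is `0`
  -- at `t = 0`.
  set K : ℝ := 2 * |μ| + C + 1 with hK
  set g : ℝ → ℝ := fun t => ∫ s in (0 : ℝ)..t, |w s| with hg
  have hvd : ∀ t, 0 < t → HasDerivAt (fun t => (w t ^ 2 + g t ^ 2) * Real.exp (-(K * t)))
      ((2 * w t * (-(μ * w t) - ∫ s in (0 : ℝ)..t, M (t - s) * w s) + 2 * g t * |w t|
        - K * (w t ^ 2 + g t ^ 2)) * Real.exp (-(K * t))) t := by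
    intro t ht
    have h1 := ((hd t ht).pow 2).add ((hgd t ht).pow 2)
    have h2 : HasDerivAt (fun t => Real.exp (-(K * t))) (Real.exp (-(K * t)) * (-(K * 1))) t :=
      (((hasDerivAt_id t).const_mul K).neg).exp
    refine (h1.mul h2).congr_deriv ?_
    simp only [Pi.add_apply, Pi.pow_apply, Nat.cast_ofNat]
    ring
  have hanti : AntitoneOn (fun t => (w t ^ 2 + g t ^ 2) * Real.exp (-(K * t))) (Icc 0 T) := by
    refine antitoneOn_of_deriv_nonpos (convex_Icc 0 T) ?_ ?_ ?_
    · exact (((hw.mono Icc_subset_Ici_self).pow 2).add (hgc.pow 2)).mul (by fun_prop)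
    · rw [interior_Icc]
      exact fun t ht => (hvd t ht.1).differentiableAt.differentiableWithinAt
    · rw [interior_Icc]
      intro t ht
      rw [(hvd t ht.1).deriv]
      refine mul_nonpos_of_nonpos_of_nonneg ?_ (Real.exp_nonneg _)
      have h1 : -(2 * w t * μ * w t) ≤ 2 * |μ| * w t ^ 2 := by
        nlinarith [neg_abs_le μ, sq_nonneg (w t)]
      have h2 : -(2 * w t * ∫ s in (0 : ℝ)..t, M (t - s) * w s) ≤ 2 * |w t| * (C * g t) := by
        refine (neg_le_abs _).trans ?_
        rw [abs_mul, abs_mul, abs_two]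
        exact mul_le_mul_of_nonneg_left (hker t ht.1 ht.2.le) (by positivity)
      have h3 : 2 * |w t| * g t ≤ w t ^ 2 + g t ^ 2 := by
        nlinarith [sq_nonneg (|w t| - g t), sq_abs (w t)]
      nlinarith [mul_le_mul_of_nonneg_left h3 hC0, abs_nonneg μ, sq_nonneg (g t),
        mul_nonneg (abs_nonneg μ) (sq_nonneg (g t))]
  have hle := hanti ⟨le_rfl, hT.le⟩ ⟨hT.le, le_rfl⟩ hT.le
  have hg0 : g 0 = 0 := by simp [hg]
  simp only [h0, hg0] at hle
  have h4 : w T ^ 2 + g T ^ 2 ≤ 0 := by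
    by_contra! h
    have := mul_pos h (Real.exp_pos (-(K * T)))
    norm_num at hle
    linarith
  nlinarith [sq_nonneg (w T), sq_nonneg (g T)]

theorem eq_mul_of_isModeSolution {M u x : ℝ → ℝ} {μ : ℝ} (hM : ContinuousOn M (Ici 0))
    (hx : IsModeSolution M μ x) (hu : ContinuousOn u (Ici 0))
    (hd : ∀ t : ℝ, 0 < t →
      HasDerivAt u (-(μ * u t) - ∫ s in (0 : ℝ)..t, M (t - s) * u s) t)
    {T : ℝ} (hT : 0 < T) : u T = u 0 * x T := by
  obtain ⟨hxc, hx0, hxd⟩ := hx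
  have hint : ∀ v : ℝ → ℝ, ContinuousOn v (Ici 0) → ∀ t, 0 < t →
      IntervalIntegrable (fun s => M (t - s) * v s) volume 0 t := by
    intro v hv t ht
    refine ContinuousOn.intervalIntegrable ?_
    rw [uIcc_of_le ht.le]
    refine ContinuousOn.mul (hM.comp (by fun_prop) fun s hs => ?_)
      (hv.mono Icc_subset_Ici_self)
    simpa using hs.2
  have := eq_zero_of_volterra (w := fun t => u t - u 0 * x t) (μ := μ) hM
    (hu.sub (continuousOn_const.mul hxc)) (by simp [hx0]) ?_ hT
  · simpa [sub_eq_zero] using this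
  intro t ht
  refine ((hd t ht).sub ((hxd t ht).const_mul (u 0))).congr_deriv ?_
  have : ∫ s in (0 : ℝ)..t, M (t - s) * (u s - u 0 * x s) =
      (∫ s in (0 : ℝ)..t, M (t - s) * u s) - u 0 * ∫ s in (0 : ℝ)..t, M (t - s) * x s := by
    rw [← intervalIntegral.integral_const_mul, ← intervalIntegral.integral_sub (hint u hu t ht)
      ((hint x hxc t ht).const_mul _)]
    congr 1
    ext s
    ring
  rw [this]
  ring

section

variable {n : ℕ} {Ω : TopologicalSpace.Opens (EuclideanSpace ℝ (Fin n))}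

/-! ### Test functions and the space `H₀¹(Ω)` -/

theorem memLp_testFunction (φ : 𝓓(Ω, ℝ)) :
    MemLp φ 2 ((volume : Measure (EuclideanSpace ℝ (Fin n))).restrict Ω) :=
  φ.continuous.memLp_of_hasCompactSupport φ.hasCompactSupport

/-- The class of a test function in `L²(Ω)`, as a linear map. -/
noncomputable def testToL2 (Ω : TopologicalSpace.Opens (EuclideanSpace ℝ (Fin n))) :
    𝓓(Ω, ℝ) →ₗ[ℝ] L2 Ω where
  toFun φ := (memLp_testFunction φ).toLp φ
  map_add' φ ψ := MemLp.toLp_add (memLp_testFunction φ) (memLp_testFunction ψ)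
  map_smul' c φ := MemLp.toLp_const_smul c (memLp_testFunction φ)

theorem coeFn_testToL2 (φ : 𝓓(Ω, ℝ)) :
    testToL2 Ω φ =ᵐ[(volume : Measure (EuclideanSpace ℝ (Fin n))).restrict Ω] φ :=
  MemLp.coeFn_toLp (memLp_testFunction φ)

theorem differentiable_testFunction (φ : 𝓓(Ω, ℝ)) : Differentiable ℝ φ :=
  φ.contDiff.differentiable (by simp)

/-- The partial derivative `∂ᵢ` on test functions. -/
noncomputable def partialDeriv (i : Fin n) : 𝓓(Ω, ℝ) →ₗ[ℝ] 𝓓(Ω, ℝ) where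
  toFun φ :=
    { toFun := fun z => fderiv ℝ φ z (EuclideanSpace.single i (1 : ℝ))
      contDiff' := (φ.contDiff.fderiv_right (by simp)).clm_apply contDiff_const
      hasCompactSupport' := φ.hasCompactSupport.fderiv_apply ℝ _
      tsupport_subset' := (tsupport_fderiv_apply_subset ℝ _).trans φ.tsupport_subset }
  map_add' φ ψ := by
    ext z
    change fderiv ℝ (⇑φ + ⇑ψ) z _ = fderiv ℝ φ z _ + fderiv ℝ ψ z _
    rw [fderiv_add (differentiable_testFunction φ z) (differentiable_testFunction ψ z)]
    rfl
  map_smul' c φ := by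
    ext z
    change fderiv ℝ (c • ⇑φ) z _ = c • fderiv ℝ φ z _
    rw [fderiv_const_smul (differentiable_testFunction φ z)]
    rfl

theorem partialDeriv_apply (i : Fin n) (φ : 𝓓(Ω, ℝ)) (z : EuclideanSpace ℝ (Fin n)) :
    partialDeriv i φ z = fderiv ℝ φ z (EuclideanSpace.single i (1 : ℝ)) := rfl

theorem laplacian_testFunction (φ : 𝓓(Ω, ℝ)) :
    Δ (φ : EuclideanSpace ℝ (Fin n) → ℝ) = ⇑(∑ i, partialDeriv i (partialDeriv i φ)) := by
  ext z
  rw [InnerProductSpace.laplacian_eq_iteratedFDeriv_orthonormalBasis _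
    (EuclideanSpace.basisFun (Fin n) ℝ), FunLike.coe_sum, Finset.sum_apply]
  refine Finset.sum_congr rfl fun i _ => ?_
  have h : DifferentiableAt ℝ (fderiv ℝ φ) z :=
    (φ.contDiff.fderiv_right (m := ((⊤ : ℕ∞) : WithTop ℕ∞)) (by simp)).differentiable (by simp) z
  rw [iteratedFDeriv_two_apply, partialDeriv_apply]
  change _ = fderiv ℝ (fun z => fderiv ℝ φ z (EuclideanSpace.single i (1 : ℝ))) z _
  rw [fderiv_clm_apply h (differentiableAt_const _)]
  simp

theorem inner_testToL2 (f : L2 Ω) (φ : 𝓓(Ω, ℝ)) :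
    ⟪f, testToL2 Ω φ⟫ = ∫ z in (Ω : Set (EuclideanSpace ℝ (Fin n))), f z * φ z := by
  rw [L2.inner_def]
  refine integral_congr_ae ?_
  filter_upwards [coeFn_testToL2 φ] with z hz
  rw [hz]
  simp [mul_comm]

theorem eq_zero_of_notMem (φ : 𝓓(Ω, ℝ)) {z : EuclideanSpace ℝ (Fin n)} (hz : z ∉ Ω) : φ z = 0 :=
  image_eq_zero_of_notMem_tsupport (f := φ) fun h => hz (φ.tsupport_subset h)

theorem inner_testToL2_testToL2 (φ ψ : 𝓓(Ω, ℝ)) :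
    ⟪testToL2 Ω φ, testToL2 Ω ψ⟫ = ∫ z, φ z * ψ z := by
  rw [inner_testToL2, ← setIntegral_eq_integral_of_forall_compl_eq_zero
    (s := (Ω : Set (EuclideanSpace ℝ (Fin n)))) (f := fun z => φ z * ψ z)]
  · refine integral_congr_ae ?_
    filter_upwards [coeFn_testToL2 φ] with z hz
    rw [hz]
  · intro z hz
    rw [eq_zero_of_notMem φ hz, zero_mul]

theorem integrable_mul_testFunction (φ ψ : 𝓓(Ω, ℝ)) : Integrable (fun z => φ z * ψ z) :=
  (φ.continuous.mul ψ.continuous).integrable_of_hasCompactSupport φ.hasCompactSupport.mul_right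

theorem inner_partialDeriv (i : Fin n) (φ ψ : 𝓓(Ω, ℝ)) :
    ⟪testToL2 Ω φ, testToL2 Ω (partialDeriv i ψ)⟫ =
      -⟪testToL2 Ω (partialDeriv i φ), testToL2 Ω ψ⟫ := by
  rw [inner_testToL2_testToL2, inner_testToL2_testToL2]
  exact integral_mul_fderiv_eq_neg_fderiv_mul_of_integrable
    (integrable_mul_testFunction (partialDeriv i φ) ψ)
    (integrable_mul_testFunction φ (partialDeriv i ψ)) (integrable_mul_testFunction φ ψ)
    (fun z _ => differentiable_testFunction φ z) (fun z _ => differentiable_testFunction ψ z)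

/-- The distributional Laplacian in terms of inner products with second partial derivatives. -/
theorem hasWeakLaplacian_iff {f g : L2 Ω} : HasWeakLaplacian Ω f g ↔
    ∀ φ : 𝓓(Ω, ℝ), ∑ i, ⟪f, testToL2 Ω (partialDeriv i (partialDeriv i φ))⟫ =
      ⟪g, testToL2 Ω φ⟫ := by
  refine forall_congr' fun φ => ?_
  rw [laplacian_testFunction, ← inner_testToL2, ← inner_testToL2, map_sum, inner_sum]

/-- The ambient Hilbert space `L²(Ω) × L²(Ω)ⁿ` of pairs of a function (index `none`) and a
gradient (indices `some i`). -/
abbrev Jet (Ω : TopologicalSpace.Opens (EuclideanSpace ℝ (Fin n))) : Type :=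
  PiLp 2 (fun _ : Option (Fin n) => L2 Ω)

/-- The `1`-jet `(φ, ∂₁φ, …, ∂ₙφ)` of a test function. -/
noncomputable def testJet (Ω : TopologicalSpace.Opens (EuclideanSpace ℝ (Fin n))) :
    𝓓(Ω, ℝ) →ₗ[ℝ] Jet Ω where
  toFun φ := WithLp.toLp 2 fun o => o.elim (testToL2 Ω φ) fun i => testToL2 Ω (partialDeriv i φ)
  map_add' φ ψ := by
    ext1 o
    cases o <;> simp
  map_smul' c φ := by
    ext1 o
    cases o <;> simp

@[simp] theorem testJet_none (φ : 𝓓(Ω, ℝ)) : testJet Ω φ none = testToL2 Ω φ := rfl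

@[simp] theorem testJet_some (φ : 𝓓(Ω, ℝ)) (i : Fin n) :
    testJet Ω φ (some i) = testToL2 Ω (partialDeriv i φ) := rfl

/-- The Hilbert space `H₀¹(Ω)`, realised as the space of pairs `(f, ∇f)`: the closure of the
`1`-jets of test functions. -/
noncomputable def H10 (Ω : TopologicalSpace.Opens (EuclideanSpace ℝ (Fin n))) :
    Submodule ℝ (Jet Ω) :=
  (LinearMap.range (testJet Ω)).topologicalClosure

instance : CompleteSpace (H10 Ω) := Submodule.topologicalClosure.completeSpace _

theorem tendsto_testToL2_iff {φ : ℕ → 𝓓(Ω, ℝ)} {f : L2 Ω} :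
    Tendsto (fun j => testToL2 Ω (φ j)) atTop (𝓝 f) ↔
      Tendsto (fun j => eLpNorm (fun z => φ j z - f z) 2
        ((volume : Measure (EuclideanSpace ℝ (Fin n))).restrict Ω)) atTop (𝓝 0) := by
  rw [Lp.tendsto_Lp_iff_tendsto_eLpNorm']
  refine tendsto_congr fun j => eLpNorm_congr_ae ?_
  filter_upwards [coeFn_testToL2 (φ j)] with z hz
  rw [Pi.sub_apply, hz]

/-- The Hilbert space `H10 Ω` consists of the pairs `(f, G)` that occur in `MemH10`. -/
theorem memH10_iff {f : L2 Ω} : MemH10 Ω f ↔ ∃ U ∈ H10 Ω, U none = f := by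
  constructor
  · rintro ⟨G, φ, hφ, hG⟩
    refine ⟨WithLp.toLp 2 fun o => o.elim f G, ?_, rfl⟩
    refine mem_closure_of_tendsto (f := fun j => testJet Ω (φ j)) (b := atTop) ?_
      (Eventually.of_forall fun j => LinearMap.mem_range_self _ _)
    refine ((PiLp.continuous_toLp 2 _).tendsto _).comp (tendsto_pi_nhds.2 fun o => ?_)
    cases o with
    | none => exact tendsto_testToL2_iff.2 hφ
    | some i => exact tendsto_testToL2_iff (φ := fun j => partialDeriv i (φ j)) |>.2 (hG i)
  · rintro ⟨U, hU, rfl⟩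
    obtain ⟨u, hu, hlim⟩ := mem_closure_iff_seq_limit.1 hU
    choose φ hφ using hu
    obtain rfl : u = fun j => testJet Ω (φ j) := funext fun j => (hφ j).symm
    have hlim' := tendsto_pi_nhds.1 (((PiLp.continuous_ofLp 2 _).tendsto _).comp hlim)
    exact ⟨fun i => U (some i), φ, tendsto_testToL2_iff.1 (hlim' none),
      fun i => tendsto_testToL2_iff (φ := fun j => partialDeriv i (φ j)) |>.1 (hlim' (some i))⟩

/-- A closed condition holds on `H₀¹(Ω)` as soon as it holds for test functions. -/
theorem H10.induction {p : Jet Ω → Prop} (hp : IsClosed {U | p U})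
    (h : ∀ φ : 𝓓(Ω, ℝ), p (testJet Ω φ)) {U : Jet Ω} (hU : U ∈ H10 Ω) : p U := by
  refine closure_minimal (t := {U | p U}) ?_ hp hU
  rintro _ ⟨φ, rfl⟩
  exact h φ

/-- The components `U (some i)` of an element of `H₀¹(Ω)` are the weak derivatives of `U none`. -/
theorem inner_gradient_partialDeriv {U : Jet Ω} (hU : U ∈ H10 Ω) (i : Fin n) (ψ : 𝓓(Ω, ℝ)) :
    ⟪U none, testToL2 Ω (partialDeriv i ψ)⟫ = -⟪U (some i), testToL2 Ω ψ⟫ :=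
  H10.induction (p := fun U => ⟪U none, testToL2 Ω (partialDeriv i ψ)⟫ =
    -⟪U (some i), testToL2 Ω ψ⟫) (isClosed_eq (by fun_prop) (by fun_prop))
    (fun φ => inner_partialDeriv i φ ψ) hU

/-- The variational form of the distributional Laplacian: on `H₀¹(Ω)`, `Δ f = g` means
`∫ ∇f ⬝ ∇w = -∫ g w` for all `w ∈ H₀¹(Ω)`. -/
theorem hasWeakLaplacian_iff_forall_H10 {U : Jet Ω} (hU : U ∈ H10 Ω) {g : L2 Ω} :
    HasWeakLaplacian Ω (U none) g ↔
      ∀ W ∈ H10 Ω, ∑ i, ⟪U (some i), W (some i)⟫ = -⟪g, W none⟫ := by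
  have key : HasWeakLaplacian Ω (U none) g ↔
      ∀ φ : 𝓓(Ω, ℝ), ∑ i, ⟪U (some i), testJet Ω φ (some i)⟫ = -⟪g, testJet Ω φ none⟫ := by
    rw [hasWeakLaplacian_iff]
    refine forall_congr' fun φ => ?_
    simp only [inner_gradient_partialDeriv hU, Finset.sum_neg_distrib, testJet_some, testJet_none]
    exact neg_eq_iff_eq_neg
  refine key.trans ⟨fun h W hW => ?_, fun h φ => h _ ?_⟩
  · exact H10.induction (p := fun W => ∑ i, ⟪U (some i), W (some i)⟫ = -⟪g, W none⟫)
      (isClosed_eq (by fun_prop) (by fun_prop)) h hW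
  · exact Submodule.le_topologicalClosure _ (LinearMap.mem_range_self _ φ)

/-- The Dirichlet Laplacian is symmetric: both sides are `-∫ ∇f ⬝ ∇g`. -/
theorem inner_dirichletLaplacian_comm {f Af g Ag : L2 Ω} (hf : DirichletLaplacian Ω f Af)
    (hg : DirichletLaplacian Ω g Ag) : ⟪f, Ag⟫ = ⟪Af, g⟫ := by
  obtain ⟨U, hU, rfl⟩ := memH10_iff.1 hf.1
  obtain ⟨W, hW, rfl⟩ := memH10_iff.1 hg.1
  have h1 := (hasWeakLaplacian_iff_forall_H10 hU).1 hf.2 W hW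
  have h2 := (hasWeakLaplacian_iff_forall_H10 hW).1 hg.2 U hU
  rw [real_inner_comm, ← neg_inj, ← h1, ← h2]
  exact Finset.sum_congr rfl fun i _ => real_inner_comm _ _

theorem eq_zero_of_forall_inner_testToL2 {f : L2 Ω} (h : ∀ φ : 𝓓(Ω, ℝ), ⟪f, testToL2 Ω φ⟫ = 0) :
    f = 0 := by
  have hf : LocallyIntegrableOn f (Ω : Set (EuclideanSpace ℝ (Fin n))) := by
    have := (Lp.memLp f).locallyIntegrable one_le_two
    exact (locallyIntegrableOn_of_locallyIntegrable_restrict this)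
  have := Ω.isOpen.ae_eq_zero_of_integral_contDiff_smul_eq_zero hf fun g hg hs hsub => by
    rw [← h ⟨g, hg, hs, hsub⟩, inner_testToL2, ← setIntegral_eq_integral_of_forall_compl_eq_zero
      (s := (Ω : Set (EuclideanSpace ℝ (Fin n))))]
    · exact integral_congr_ae (Eventually.of_forall fun z => mul_comm _ _)
    · intro z hz
      rw [image_eq_zero_of_notMem_tsupport fun h => hz (hsub h), zero_smul]
  refine Lp.ext ?_
  filter_upwards [(ae_restrict_iff' Ω.isOpen.measurableSet).2 this, Lp.coeFn_zero ℝ 2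
    ((volume : Measure (EuclideanSpace ℝ (Fin n))).restrict Ω)] with z h1 h2
  rw [h1, h2, Pi.zero_apply]

/-! ### The resolvent and completeness of the eigenfunctions -/

/-- The inclusion `H₀¹(Ω) → L²(Ω)`, `(f, ∇f) ↦ f`. -/
noncomputable def inclusionH10 (Ω : TopologicalSpace.Opens (EuclideanSpace ℝ (Fin n))) :
    H10 Ω →L[ℝ] L2 Ω :=
  (PiLp.proj 2 (fun _ : Option (Fin n) => L2 Ω) none).comp (H10 Ω).subtypeL

/-- The defining property of `u = J† f`: `∫ u w + ∫ ∇u ⬝ ∇w = ∫ f w` for all `w ∈ H₀¹(Ω)`. -/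
theorem inner_adjoint_inclusionH10 (f : L2 Ω) {W : Jet Ω} (hW : W ∈ H10 Ω) :
    ⟪(((inclusionH10 Ω).adjoint f : H10 Ω) : Jet Ω) none, W none⟫ +
      ∑ i, ⟪(((inclusionH10 Ω).adjoint f : H10 Ω) : Jet Ω) (some i), W (some i)⟫ = ⟪f, W none⟫ := by
  have := ContinuousLinearMap.adjoint_inner_left (inclusionH10 Ω) ⟨W, hW⟩ f
  rw [Submodule.coe_inner, PiLp.inner_apply, Fintype.sum_option] at this
  exact this

/-- The operator `(1 - A)⁻¹` on `L²(Ω)`. For the inner product `∫ u w + ∫ ∇u ⬝ ∇w` of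
`H₀¹(Ω)`, the adjoint of the inclusion sends `f` to the solution `u` of the weak form of
`u - Δ u = f`. -/
noncomputable def dirichletResolvent (Ω : TopologicalSpace.Opens (EuclideanSpace ℝ (Fin n))) :
    L2 Ω →L[ℝ] L2 Ω :=
  (inclusionH10 Ω).comp (inclusionH10 Ω).adjoint

theorem isSymmetric_dirichletResolvent : (dirichletResolvent Ω : L2 Ω →ₗ[ℝ] L2 Ω).IsSymmetric := by
  intro f g
  change ⟪inclusionH10 Ω ((inclusionH10 Ω).adjoint f), g⟫ =
    ⟪f, inclusionH10 Ω ((inclusionH10 Ω).adjoint g)⟫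
  rw [← ContinuousLinearMap.adjoint_inner_right, ContinuousLinearMap.adjoint_inner_left]

/-- An eigenfunction of `(1 - A)⁻¹` for `c ≠ 0` is one of `-A` for `c⁻¹ - 1`. -/
theorem dirichletLaplacian_of_dirichletResolvent_eq_smul {f : L2 Ω} {c : ℝ} (hc : c ≠ 0)
    (h : dirichletResolvent Ω f = c • f) : DirichletLaplacian Ω f (-((c⁻¹ - 1) • f)) := by
  set V : Jet Ω := (((inclusionH10 Ω).adjoint f : H10 Ω) : Jet Ω) with hV
  have hVmem : V ∈ H10 Ω := Subtype.coe_prop _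
  have hV0 : V none = c • f := h
  have hU : c⁻¹ • V ∈ H10 Ω := Submodule.smul_mem _ _ hVmem
  have hU0 : (c⁻¹ • V) none = f := by
    rw [PiLp.smul_apply, hV0, inv_smul_smul₀ hc]
  refine ⟨memH10_iff.2 ⟨_, hU, hU0⟩, ?_⟩
  have := (hasWeakLaplacian_iff_forall_H10 hU (g := -((c⁻¹ - 1) • f))).2 ?_
  · rwa [hU0] at this
  intro W hW
  have h1 := inner_adjoint_inclusionH10 f hW
  rw [← hV, hV0, real_inner_smul_left] at h1
  have h2 : ∑ i, ⟪V (some i), W (some i)⟫ = (1 - c) * ⟪f, W none⟫ := by linarith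
  simp only [PiLp.smul_apply, real_inner_smul_left, ← Finset.mul_sum, inner_neg_left, h2]
  field_simp

/-- `(1 - A)⁻¹` is injective: its kernel is orthogonal to all test functions. -/
theorem eq_zero_of_dirichletResolvent_eq_zero {f : L2 Ω}
    (h : dirichletResolvent Ω f = 0) : f = 0 := by
  have h0 : (inclusionH10 Ω).adjoint f = 0 := by
    refine (inner_self_eq_zero (𝕜 := ℝ)).1 ?_
    rw [ContinuousLinearMap.adjoint_inner_left]
    change ⟪f, dirichletResolvent Ω f⟫ = 0
    rw [h, inner_zero_right]
  refine eq_zero_of_forall_inner_testToL2 fun φ => ?_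
  have := inner_adjoint_inclusionH10 f (W := testJet Ω φ)
    (Submodule.le_topologicalClosure _ (LinearMap.mem_range_self _ φ))
  rw [h0] at this
  simpa using this.symm

/-- If `H₀¹(Ω)` is compactly embedded in `L²(Ω)`, the eigenfunctions of the Dirichlet Laplacian
are complete. -/
theorem eq_zero_of_forall_inner_eigenfunction (hcomp : IsCompactOperator (inclusionH10 Ω))
    {f : L2 Ω} (h : ∀ (c : ℝ) (g : L2 Ω), DirichletLaplacian Ω g (-(c • g)) → ⟪f, g⟫ = 0) :
    f = 0 := by
  have hT : IsCompactOperator (dirichletResolvent Ω) := hcomp.comp_clm _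
  have hbot := ContinuousLinearMap.orthogonalComplement_iSup_eigenspaces_eq_bot hT
    isSymmetric_dirichletResolvent
  rw [← Submodule.mem_bot ℝ (x := f), ← hbot, ← Submodule.iInf_orthogonal, Submodule.mem_iInf]
  intro c
  rw [Submodule.mem_orthogonal']
  intro g hg
  rw [Module.End.mem_eigenspace_iff] at hg
  -- The kernel is trivial, and every other eigenspace consists of eigenfunctions of `A`.
  rcases eq_or_ne c 0 with rfl | hc
  · have hg0 : g = 0 := eq_zero_of_dirichletResolvent_eq_zero (by simpa using hg)
    rw [hg0, inner_zero_right]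
  · exact h _ g (dirichletLaplacian_of_dirichletResolvent_eq_smul hc hg)

/-! ### Rellich's theorem -/

theorem eLpNorm_two_sq {α : Type*} {m : MeasurableSpace α} {ν : Measure α} (f : α → ℝ) :
    eLpNorm f 2 ν ^ 2 = ∫⁻ x, ‖f x‖ₑ ^ 2 ∂ν := by
  have := eLpNorm_nnreal_pow_eq_lintegral (μ := ν) (f := f) (p := 2) two_ne_zero
  simpa using this

/-- Jensen's inequality for the square. -/
theorem enorm_integral_sq_le {α : Type*} {m : MeasurableSpace α} {ν : Measure α}
    [IsProbabilityMeasure ν] {f : α → ℝ} (hf : AEStronglyMeasurable f ν) :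
    ‖∫ x, f x ∂ν‖ₑ ^ 2 ≤ ∫⁻ x, ‖f x‖ₑ ^ 2 ∂ν := by
  rw [← eLpNorm_two_sq]
  gcongr
  calc ‖∫ x, f x ∂ν‖ₑ ≤ ∫⁻ x, ‖f x‖ₑ ∂ν := enorm_integral_le_lintegral_enorm f
    _ = eLpNorm f 1 ν := (eLpNorm_one_eq_lintegral_enorm).symm
    _ ≤ eLpNorm f 2 ν := eLpNorm_le_eLpNorm_of_exponent_le one_le_two hf

theorem enorm_fderiv_apply_sq_le (φ : 𝓓(Ω, ℝ)) (y z : EuclideanSpace ℝ (Fin n)) :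
    ‖fderiv ℝ φ y z‖ₑ ^ 2 ≤ ‖z‖ₑ ^ 2 * ∑ i, ‖partialDeriv i φ y‖ₑ ^ 2 := by
  have hz : fderiv ℝ φ y z = ∑ i, z i * partialDeriv i φ y := by
    conv_lhs => rw [← (EuclideanSpace.basisFun (Fin n) ℝ).sum_repr z]
    simp [partialDeriv_apply]
  have hreal : ‖fderiv ℝ φ y z‖ ^ 2 ≤ ‖z‖ ^ 2 * ∑ i, ‖partialDeriv i φ y‖ ^ 2 := by
    rw [hz, EuclideanSpace.real_norm_sq_eq]
    simp only [Real.norm_eq_abs, sq_abs]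
    exact Finset.sum_mul_sq_le_sq_mul_sq _ _ _
  simp only [← ofReal_norm, ← ENNReal.ofReal_pow (norm_nonneg _)]
  rw [← ENNReal.ofReal_sum_of_nonneg fun i _ => by positivity, ← ENNReal.ofReal_mul (by positivity)]
  exact ENNReal.ofReal_le_ofReal hreal

/-- Translates of a test function: `‖φ(· + z) - φ‖ ≤ |z| ‖∇φ‖` in `L²`. -/
theorem lintegral_translate_sub_sq_le (φ : 𝓓(Ω, ℝ)) (z : EuclideanSpace ℝ (Fin n)) :
    ∫⁻ x, ‖φ (x + z) - φ x‖ₑ ^ 2 ≤ ‖z‖ₑ ^ 2 * ∑ i, ∫⁻ x, ‖partialDeriv i φ x‖ₑ ^ 2 := by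
  have : IsProbabilityMeasure ((volume : Measure ℝ).restrict (Ioc 0 1)) := ⟨by simp⟩
  have hcf : Continuous (fderiv ℝ φ) := φ.contDiff.continuous_fderiv (by simp)
  have hpt : ∀ x, ‖φ (x + z) - φ x‖ₑ ^ 2 ≤
      ∫⁻ t in Ioc (0 : ℝ) 1, ‖fderiv ℝ φ (x + t • z) z‖ₑ ^ 2 := by
    intro x
    have hc : Continuous fun t : ℝ => fderiv ℝ φ (x + t • z) z := by fun_prop
    have hftc : ∫ t in (0 : ℝ)..1, fderiv ℝ φ (x + t • z) z = φ (x + z) - φ x := by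
      rw [intervalIntegral.integral_eq_sub_of_hasDerivAt (f := fun t : ℝ => φ (x + t • z))
        (fun t _ => ?_) (hc.intervalIntegrable 0 1)]
      · simp
      · have h1 : HasDerivAt (fun t : ℝ => x + t • z) z t := by
          simpa using ((hasDerivAt_id t).smul_const z).const_add x
        exact (differentiable_testFunction φ _).hasFDerivAt.comp_hasDerivAt t h1
    rw [← hftc, intervalIntegral.integral_of_le zero_le_one]
    exact enorm_integral_sq_le hc.aestronglyMeasurable
  calc ∫⁻ x, ‖φ (x + z) - φ x‖ₑ ^ 2
      ≤ ∫⁻ x, ∫⁻ t in Ioc (0 : ℝ) 1, ‖fderiv ℝ φ (x + t • z) z‖ₑ ^ 2 := lintegral_mono hpt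
    _ = ∫⁻ t in Ioc (0 : ℝ) 1, ∫⁻ x, ‖fderiv ℝ φ (x + t • z) z‖ₑ ^ 2 := by
        refine lintegral_lintegral_swap (Measurable.aemeasurable ?_)
        have : Continuous fun p : EuclideanSpace ℝ (Fin n) × ℝ =>
          ‖fderiv ℝ φ (p.1 + p.2 • z) z‖ₑ ^ 2 := by fun_prop
        exact this.measurable
    _ = ∫⁻ t in Ioc (0 : ℝ) 1, ∫⁻ x, ‖fderiv ℝ φ x z‖ₑ ^ 2 := by
        refine lintegral_congr fun t => ?_
        exact lintegral_add_right_eq_self (fun x => ‖fderiv ℝ φ x z‖ₑ ^ 2) (t • z)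
    _ = ∫⁻ x, ‖fderiv ℝ φ x z‖ₑ ^ 2 := by simp
    _ ≤ ∫⁻ x, ‖z‖ₑ ^ 2 * ∑ i, ‖partialDeriv i φ x‖ₑ ^ 2 :=
        lintegral_mono fun x => enorm_fderiv_apply_sq_le φ x z
    _ = ‖z‖ₑ ^ 2 * ∑ i, ∫⁻ x, ‖partialDeriv i φ x‖ₑ ^ 2 := by
        have hm : ∀ i, Measurable fun x => ‖partialDeriv i φ x‖ₑ ^ 2 := fun i => by
          have : Continuous fun x => ‖partialDeriv i φ x‖ₑ ^ 2 := by fun_prop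
          exact this.measurable
        rw [lintegral_const_mul _ (Finset.measurable_sum _ fun i _ => hm i),
          lintegral_finsetSum _ fun i _ => hm i]

theorem enorm_L2_sq (f : L2 Ω) :
    ‖f‖ₑ ^ 2 = ∫⁻ x in (Ω : Set (EuclideanSpace ℝ (Fin n))), ‖f x‖ₑ ^ 2 := by
  rw [Lp.enorm_def, eLpNorm_two_sq]

theorem enorm_testToL2_sq (φ : 𝓓(Ω, ℝ)) : ‖testToL2 Ω φ‖ₑ ^ 2 = ∫⁻ x, ‖φ x‖ₑ ^ 2 := by
  rw [enorm_L2_sq, ← setLIntegral_eq_of_support_subset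
    (s := (Ω : Set (EuclideanSpace ℝ (Fin n)))) (f := fun x => ‖φ x‖ₑ ^ 2)]
  · refine lintegral_congr_ae ?_
    filter_upwards [coeFn_testToL2 φ] with z hz
    rw [hz]
  · intro z hz
    by_contra h
    exact hz (by simp [eq_zero_of_notMem φ h])

theorem sum_lintegral_partialDeriv_sq_le (φ : 𝓓(Ω, ℝ)) :
    ∑ i, ∫⁻ x, ‖partialDeriv i φ x‖ₑ ^ 2 ≤ ‖testJet Ω φ‖ₑ ^ 2 := by
  simp only [← enorm_testToL2_sq]
  simp only [← ofReal_norm, ← ENNReal.ofReal_pow (norm_nonneg _)]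
  rw [← ENNReal.ofReal_sum_of_nonneg fun i _ => by positivity]
  refine ENNReal.ofReal_le_ofReal ?_
  rw [PiLp.norm_sq_eq_of_L2, Fintype.sum_option]
  simp only [testJet_some, testJet_none]
  linarith [sq_nonneg ‖testToL2 Ω φ‖]

/-- A bounded set is partitioned into finitely many measurable pieces, the level sets of `c`, each
within distance `r` of the value of `c` on it. -/
theorem exists_simpleFunc_dist_lt {s : Set (EuclideanSpace ℝ (Fin n))}
    (hs : Bornology.IsBounded s) {r : ℝ} (hr : 0 < r) :
    ∃ c : SimpleFunc (EuclideanSpace ℝ (Fin n)) (EuclideanSpace ℝ (Fin n)),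
      ∀ x ∈ s, dist (c x) x < r := by
  let e := TopologicalSpace.denseSeq (EuclideanSpace ℝ (Fin n))
  obtain ⟨t, ht⟩ := hs.isCompact_closure.elim_finite_subcover (fun k => Metric.ball (e k) r)
    (fun k => Metric.isOpen_ball) fun x _ => by
      obtain ⟨k, hk⟩ := (TopologicalSpace.denseRange_denseSeq
        (EuclideanSpace ℝ (Fin n))).exists_dist_lt x hr
      exact mem_iUnion.2 ⟨k, hk⟩
  refine ⟨SimpleFunc.nearestPt e (t.sup id), fun x hx => ?_⟩
  obtain ⟨k, hk, hkx⟩ := mem_iUnion₂.1 (ht (subset_closure hx))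
  have h1 := SimpleFunc.edist_nearestPt_le e x (Finset.le_sup (f := id) hk)
  simp only [id, edist_dist] at h1
  rw [Metric.mem_ball, dist_comm] at hkx
  exact ((ENNReal.ofReal_le_ofReal_iff dist_nonneg).1 h1).trans_lt hkx

/-- The operator replacing `f` by the constant `ρ ∫_{Ω ∩ B(a, r)} f` on each level set `{c = a}` is
compact, as its range is finite-dimensional. -/
theorem exists_isCompactOperator_average
    (hbdd : Bornology.IsBounded (Ω : Set (EuclideanSpace ℝ (Fin n))))
    (c : SimpleFunc (EuclideanSpace ℝ (Fin n)) (EuclideanSpace ℝ (Fin n))) (r ρ : ℝ) :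
    ∃ P : L2 Ω →L[ℝ] L2 Ω, IsCompactOperator P ∧ ∀ f : L2 Ω,
      P f =ᵐ[(volume : Measure (EuclideanSpace ℝ (Fin n))).restrict Ω]
        fun x => ρ * ∫ y in Metric.ball (c x) r, f y
          ∂((volume : Measure (EuclideanSpace ℝ (Fin n))).restrict Ω) := by
  set ν := (volume : Measure (EuclideanSpace ℝ (Fin n))).restrict Ω with hν
  have hfin : IsFiniteMeasure ν := ⟨by simpa [hν] using hbdd.measure_lt_top⟩
  let ind (s : Set (EuclideanSpace ℝ (Fin n))) (hs : MeasurableSet s) : L2 Ω :=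
    indicatorConstLp 2 hs (measure_ne_top ν s) (1 : ℝ)
  let Q (a : EuclideanSpace ℝ (Fin n)) : L2 Ω →L[ℝ] L2 Ω :=
    (innerSL ℝ (ind (Metric.ball a r) measurableSet_ball)).smulRight
      (ρ • ind (c ⁻¹' {a}) (c.measurableSet_fiber a))
  have hQc : ∀ a, IsCompactOperator (Q a) := fun a =>
    (isCompactOperator_of_locallyCompactSpace_rng (ContinuousLinearMap.toSpanSingleton ℝ
      (ρ • ind (c ⁻¹' {a}) (c.measurableSet_fiber a)))).comp_clm
      (innerSL ℝ (ind (Metric.ball a r) measurableSet_ball))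
  have hQ : ∀ a (f : L2 Ω), Q a f =ᵐ[ν] (c ⁻¹' {a}).indicator fun _ =>
      ρ * ∫ y in Metric.ball a r, f y ∂ν := by
    intro a f
    have h1 : Q a f = (ρ * ∫ y in Metric.ball a r, f y ∂ν) •
        ind (c ⁻¹' {a}) (c.measurableSet_fiber a) := by
      simp only [Q, ContinuousLinearMap.smulRight_apply, innerSL_apply_apply, ind]
      rw [L2.inner_indicatorConstLp_one, smul_smul, mul_comm]
    rw [h1]
    filter_upwards [Lp.coeFn_smul (ρ * ∫ y in Metric.ball a r, f y ∂ν)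
      (ind (c ⁻¹' {a}) (c.measurableSet_fiber a)), indicatorConstLp_coeFn (p := 2) (c := (1 : ℝ))
      (hs := c.measurableSet_fiber a) (hμs := measure_ne_top ν _)] with x hx1 hx2
    rw [hx1, Pi.smul_apply, hx2]
    by_cases hx : x ∈ c ⁻¹' {a} <;> simp [hx]
  have hsum : ∀ (s : Finset (EuclideanSpace ℝ (Fin n))),
      IsCompactOperator (∑ a ∈ s, Q a : L2 Ω →L[ℝ] L2 Ω) ∧
        ∀ f : L2 Ω, (∑ a ∈ s, Q a) f =ᵐ[ν] fun x =>
          ∑ a ∈ s, (c ⁻¹' {a}).indicator (fun _ => ρ * ∫ y in Metric.ball a r, f y ∂ν) x := by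
    classical
    intro s
    induction s using Finset.induction_on with
    | empty => exact ⟨isCompactOperator_zero, fun f => Lp.coeFn_zero ℝ 2 ν⟩
    | insert a s ha ih =>
      simp only [Finset.sum_insert ha]
      refine ⟨(hQc a).add ih.1, fun f => ?_⟩
      rw [add_apply]
      filter_upwards [Lp.coeFn_add (Q a f) ((∑ a ∈ s, Q a) f), hQ a f, ih.2 f] with x h1 h2 h3
      rw [h1, Pi.add_apply, h2, h3]
  refine ⟨∑ a ∈ c.range, Q a, (hsum _).1, fun f => ((hsum _).2 f).trans ?_⟩
  refine Eventually.of_forall fun x => ?_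
  change ∑ a ∈ c.range, _ = _
  rw [Finset.sum_eq_single (c x)]
  · rw [indicator_of_mem (by simp)]
  · intro a _ ha
    exact indicator_of_notMem (fun h => ha (by simpa using h.symm)) _
  · exact fun h => absurd (SimpleFunc.mem_range_self c x) h

/-- Pointwise form of the averaging estimate: Jensen's inequality on `B(a, r)`, which is contained
in `B(x, 2r)`. -/
theorem enorm_sub_average_sq_le (φ : 𝓓(Ω, ℝ)) {x a : EuclideanSpace ℝ (Fin n)} {r : ℝ}
    (hr : 0 < r) (hxa : dist a x < r) :
    ‖φ x - (volume (Metric.ball (0 : EuclideanSpace ℝ (Fin n)) r)).toReal⁻¹ *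
        ∫ y in Metric.ball a r, φ y‖ₑ ^ 2 ≤
      (volume (Metric.ball (0 : EuclideanSpace ℝ (Fin n)) r))⁻¹ *
        ∫⁻ z in Metric.ball 0 (2 * r), ‖φ (x + z) - φ x‖ₑ ^ 2 := by
  have hvol : volume (Metric.ball a r) = volume (Metric.ball (0 : EuclideanSpace ℝ (Fin n)) r) :=
    Measure.addHaar_ball_center volume a r
  rw [← hvol]
  have hpos : volume (Metric.ball a r) ≠ 0 := (Metric.measure_ball_pos volume a hr).ne'
  have hfin : volume (Metric.ball a r) ≠ ⊤ := measure_ball_lt_top.ne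
  set ν := (volume (Metric.ball a r))⁻¹ • (volume.restrict (Metric.ball a r)) with hν
  have hprob : IsProbabilityMeasure ν := ⟨by simp [hν, ENNReal.inv_mul_cancel hpos hfin]⟩
  have hint : Integrable φ ν :=
    ((φ.continuous.integrable_of_hasCompactSupport φ.hasCompactSupport).restrict).smul_measure
      (ENNReal.inv_ne_top.2 hpos)
  have hmean : ∫ y, (φ y - φ x) ∂ν =
      -(φ x - (volume (Metric.ball a r)).toReal⁻¹ * ∫ y in Metric.ball a r, φ y) := by
    rw [integral_sub hint (integrable_const _), integral_const, hν, integral_smul_measure, ← hν]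
    simp
  have hsub : Metric.ball a r ⊆ Metric.ball x (2 * r) :=
    Metric.ball_subset_ball' (by linarith)
  calc _ = ‖∫ y, (φ y - φ x) ∂ν‖ₑ ^ 2 := by rw [hmean, enorm_neg]
    _ ≤ ∫⁻ y, ‖φ y - φ x‖ₑ ^ 2 ∂ν :=
        enorm_integral_sq_le (φ.continuous.sub continuous_const).aestronglyMeasurable
    _ = (volume (Metric.ball a r))⁻¹ * ∫⁻ y in Metric.ball a r, ‖φ y - φ x‖ₑ ^ 2 := by
        rw [hν, lintegral_smul_measure, smul_eq_mul]
    _ ≤ (volume (Metric.ball a r))⁻¹ * ∫⁻ y in Metric.ball x (2 * r), ‖φ y - φ x‖ₑ ^ 2 := by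
        gcongr
    _ = _ := by
        congr 1
        rw [← (measurePreserving_add_left volume x).setLIntegral_comp_preimage_emb
          (measurableEmbedding_addLeft x)]
        simp

/-- Replacing a test function by its local averages over balls of radius `r` changes it by at most
a constant times `r ‖φ‖_{H¹}` in `L²(Ω)`. -/
theorem lintegral_sub_average_sq_le (φ : 𝓓(Ω, ℝ)) {r : ℝ} (hr : 0 < r)
    {c : EuclideanSpace ℝ (Fin n) → EuclideanSpace ℝ (Fin n)} (hc : ∀ x ∈ Ω, dist (c x) x < r) :
    ∫⁻ x in (Ω : Set (EuclideanSpace ℝ (Fin n))),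
        ‖φ x - (volume (Metric.ball (0 : EuclideanSpace ℝ (Fin n)) r)).toReal⁻¹ *
          ∫ y in Metric.ball (c x) r, φ y‖ₑ ^ 2 ≤
      ENNReal.ofReal (2 ^ n * (2 * r) ^ 2) * ‖testJet Ω φ‖ₑ ^ 2 := by
  set b := volume (Metric.ball (0 : EuclideanSpace ℝ (Fin n)) r) with hb
  have hpos : b ≠ 0 := (Metric.measure_ball_pos volume 0 hr).ne'
  have hfin : b ≠ ⊤ := measure_ball_lt_top.ne
  have hm : Measurable fun p : EuclideanSpace ℝ (Fin n) × EuclideanSpace ℝ (Fin n) =>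
      ‖φ (p.1 + p.2) - φ p.1‖ₑ ^ 2 := by
    have : Continuous fun p : EuclideanSpace ℝ (Fin n) × EuclideanSpace ℝ (Fin n) =>
      ‖φ (p.1 + p.2) - φ p.1‖ₑ ^ 2 := by fun_prop
    exact this.measurable
  calc _ ≤ ∫⁻ x in (Ω : Set (EuclideanSpace ℝ (Fin n))),
          b⁻¹ * ∫⁻ z in Metric.ball 0 (2 * r), ‖φ (x + z) - φ x‖ₑ ^ 2 :=
        setLIntegral_mono' Ω.isOpen.measurableSet fun x hx =>
          enorm_sub_average_sq_le φ hr (hc x hx)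
    _ ≤ ∫⁻ x, b⁻¹ * ∫⁻ z in Metric.ball 0 (2 * r), ‖φ (x + z) - φ x‖ₑ ^ 2 :=
        setLIntegral_le_lintegral _ _
    _ = b⁻¹ * ∫⁻ z in Metric.ball 0 (2 * r), ∫⁻ x, ‖φ (x + z) - φ x‖ₑ ^ 2 := by
        rw [lintegral_const_mul' _ _ (ENNReal.inv_ne_top.2 hpos),
          lintegral_lintegral_swap hm.aemeasurable]
    _ ≤ b⁻¹ * ∫⁻ z in Metric.ball (0 : EuclideanSpace ℝ (Fin n)) (2 * r),
          ENNReal.ofReal (2 * r) ^ 2 * ‖testJet Ω φ‖ₑ ^ 2 := by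
        refine mul_le_mul' le_rfl (setLIntegral_mono' measurableSet_ball fun z hz => ?_)
        refine (lintegral_translate_sub_sq_le φ z).trans ?_
        gcongr
        · rw [← ofReal_norm]
          exact ENNReal.ofReal_le_ofReal (mem_ball_zero_iff.1 hz).le
        · exact sum_lintegral_partialDeriv_sq_le φ
    _ = _ := by
        rw [setLIntegral_const, Measure.addHaar_ball_mul_of_pos volume _ two_pos, ← hb,
          finrank_euclideanSpace_fin,
          ENNReal.ofReal_mul (p := 2 ^ n) (by positivity),
          ENNReal.ofReal_pow (p := 2 * r) (by positivity)]
        calc _ = (b⁻¹ * b) * (ENNReal.ofReal (2 ^ n) * ENNReal.ofReal (2 * r) ^ 2 *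
              ‖testJet Ω φ‖ₑ ^ 2) := by ring
          _ = _ := by rw [ENNReal.inv_mul_cancel hpos hfin, one_mul]

/-- `H₀¹(Ω)` functions are approximated in `L²(Ω)`, uniformly on bounded sets, by compact
operators. -/
theorem exists_isCompactOperator_norm_sub_le
    (hbdd : Bornology.IsBounded (Ω : Set (EuclideanSpace ℝ (Fin n)))) {ε : ℝ} (hε : 0 < ε) :
    ∃ P : L2 Ω →L[ℝ] L2 Ω, IsCompactOperator P ∧
      ∀ U ∈ H10 Ω, ‖U none - P (U none)‖ ≤ ε * ‖U‖ := by
  -- The radius is chosen so that the constant `2ⁿ (2r)²` of the averaging estimate is `ε²`.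
  set r : ℝ := ε / (2 * √(2 ^ n)) with hrdef
  have hr : 0 < r := by positivity
  have hconst : (2 : ℝ) ^ n * (2 * r) ^ 2 = ε ^ 2 := by
    have h2 : √((2 : ℝ) ^ n) ^ 2 = 2 ^ n := Real.sq_sqrt (by positivity)
    have h3 : 2 * r = ε / √(2 ^ n) := by rw [hrdef]; field_simp
    rw [h3, div_pow, h2]
    field_simp
  obtain ⟨c, hc⟩ := exists_simpleFunc_dist_lt hbdd hr
  obtain ⟨P, hP, hPf⟩ := exists_isCompactOperator_average hbdd c r
    (volume (Metric.ball (0 : EuclideanSpace ℝ (Fin n)) r)).toReal⁻¹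
  refine ⟨P, hP, fun U hU => H10.induction (p := fun U => ‖U none - P (U none)‖ ≤ ε * ‖U‖)
    (isClosed_le (by fun_prop) (by fun_prop)) (fun φ => ?_) hU⟩
  have hball : ∀ a, ∫ y in Metric.ball a r, testToL2 Ω φ y
      ∂((volume : Measure (EuclideanSpace ℝ (Fin n))).restrict Ω) =
        ∫ y in Metric.ball a r, φ y := by
    intro a
    rw [setIntegral_congr_ae measurableSet_ball ((coeFn_testToL2 φ).mono fun y hy _ => hy),
      Measure.restrict_restrict measurableSet_ball, inter_comm,
      ← Measure.restrict_restrict Ω.isOpen.measurableSet,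
      setIntegral_eq_integral_of_forall_compl_eq_zero fun y hy => eq_zero_of_notMem φ hy]
  have hsq : ‖testToL2 Ω φ - P (testToL2 Ω φ)‖ₑ ^ 2 ≤
      ENNReal.ofReal (ε ^ 2) * ‖testJet Ω φ‖ₑ ^ 2 := by
    rw [enorm_L2_sq, ← hconst]
    refine le_of_eq_of_le (lintegral_congr_ae ?_) (lintegral_sub_average_sq_le φ hr hc)
    filter_upwards [Lp.coeFn_sub (testToL2 Ω φ) (P (testToL2 Ω φ)), coeFn_testToL2 φ,
      hPf (testToL2 Ω φ)] with x h1 h2 h3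
    rw [h1, Pi.sub_apply, h2, h3, hball]
  simp only [← ofReal_norm] at hsq
  rw [← ENNReal.ofReal_pow (norm_nonneg _), ← ENNReal.ofReal_pow (norm_nonneg _),
    ← ENNReal.ofReal_mul (by positivity), ENNReal.ofReal_le_ofReal_iff (by positivity),
    ← mul_pow] at hsq
  exact le_of_sq_le_sq hsq (by positivity)

/-- **Rellich's theorem**: for bounded `Ω`, the inclusion of `H₀¹(Ω)` in `L²(Ω)` is compact. -/
theorem isCompactOperator_inclusionH10
    (hbdd : Bornology.IsBounded (Ω : Set (EuclideanSpace ℝ (Fin n)))) :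
    IsCompactOperator (inclusionH10 Ω) := by
  suffices hmem : inclusionH10 Ω ∈ closure {f : H10 Ω →L[ℝ] L2 Ω | IsCompactOperator f} from
    isClosed_setOfPred_isCompactOperator.closure_subset hmem
  refine (Metric.mem_closure_iff (α := H10 Ω →L[ℝ] L2 Ω)).2 fun ε hε => ?_
  obtain ⟨P, hP, hPU⟩ := exists_isCompactOperator_norm_sub_le hbdd (half_pos hε)
  refine ⟨P.comp (inclusionH10 Ω), hP.comp_clm _, ?_⟩
  refine (dist_eq_norm (inclusionH10 Ω) (P.comp (inclusionH10 Ω))).trans_lt ?_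
  refine (ContinuousLinearMap.opNorm_le_bound _ (half_pos hε).le fun U => ?_).trans_lt
    (half_lt_self hε)
  exact hPU U U.2

/-! ### Separated solutions and Fourier coefficients -/

theorem isSolution_smul_eigenfunction {M x : ℝ → ℝ} {μ : ℝ} (hx : IsModeSolution M μ x) {f : L2 Ω}
    (hf : DirichletLaplacian Ω f (-(μ • f))) : IsSolution Ω M f (fun t => x t • f) := by
  obtain ⟨hxc, hx0, hxd⟩ := hx
  refine ⟨hxc.smul continuousOn_const, by simp [hx0], fun φ Aφ hφ t ht => ?_⟩
  simp only [real_inner_smul_left, inner_dirichletLaplacian_comm hf hφ, inner_neg_left]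
  refine ((hxd t ht).mul_const ⟪f, φ⟫).congr_deriv ?_
  simp only [← mul_assoc]
  rw [intervalIntegral.integral_mul_const]
  ring

theorem IsSolution.inner_eigenfunction_eq {M x : ℝ → ℝ} {μ : ℝ} (hM : ContinuousOn M (Ici 0))
    (hx : IsModeSolution M μ x) {f : L2 Ω} (hf : DirichletLaplacian Ω f (-(μ • f))) {y₀ : L2 Ω}
    {y : ℝ → L2 Ω} (hy : IsSolution Ω M y₀ y) {t : ℝ} (ht : 0 < t) :
    ⟪y t, f⟫ = ⟪y₀, f⟫ * x t := by
  obtain ⟨hyc, rfl, hyd⟩ := hy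
  refine eq_mul_of_isModeSolution hM hx (u := fun t => ⟪y t, f⟫)
    (hyc.inner continuousOn_const) (fun s hs => ?_) ht
  refine (hyd f _ hf s hs).congr_deriv ?_
  rw [inner_neg_right, real_inner_smul_right]

end

end HeatMemory

theorem mainTheorem7 {n : ℕ} (hn : 1 ≤ n)
    (Ω : TopologicalSpace.Opens (EuclideanSpace ℝ (Fin n)))
    (hconn : IsConnected (Ω : Set (EuclideanSpace ℝ (Fin n))))
    (hbdd : Bornology.IsBounded (Ω : Set (EuclideanSpace ℝ (Fin n))))
    (hbdry : HeatMemory.HasC2Boundary Ω)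
    (M : ℝ → ℝ) (hM : ContDiffOn ℝ 2 M (Set.Ici 0))
    (lam : ℕ → ℝ) (hlam : Set.range lam = HeatMemory.dirichletEigenvalues Ω)
    (x : ℕ → ℝ → ℝ) (hx : ∀ k, HeatMemory.IsModeSolution M (lam k) (x k))
    (t₀ : ℝ) (ht₀ : 0 < t₀)
    (hN : (⋃ k, HeatMemory.positiveZeros (x k)) ≠ Set.Ioi 0) :
    HeatMemory.BackwardUniquenessAt Ω M ![t₀] ↔
      t₀ ∈ Set.Ioi 0 \ ⋃ k, HeatMemory.positiveZeros (x k) := by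
  constructor
  · refine fun h => ⟨ht₀, fun hmem => ?_⟩
    obtain ⟨k, -, hk⟩ := mem_iUnion.1 hmem
    obtain ⟨f, hf0, hf⟩ : lam k ∈ HeatMemory.dirichletEigenvalues Ω :=
      hlam ▸ mem_range_self k
    exact hf0 (h f _ (HeatMemory.isSolution_smul_eigenfunction (hx k) hf) fun j => by simp [hk])
  · rintro ⟨-, hmem⟩ y₀ y hy hyt
    have hyt₀ : y t₀ = 0 := hyt 0
    refine HeatMemory.eq_zero_of_forall_inner_eigenfunction
      (HeatMemory.isCompactOperator_inclusionH10 hbdd) fun c g hg => ?_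
    rcases eq_or_ne g 0 with rfl | hg0
    · exact inner_zero_right _
    obtain ⟨k, rfl⟩ : c ∈ range lam := hlam ▸ ⟨g, hg0, hg⟩
    have h := hy.inner_eigenfunction_eq hM.continuousOn (hx k) hg ht₀
    rw [hyt₀, inner_zero_left, eq_comm, mul_eq_zero] at h
    exact h.resolve_right fun hxk => hmem (mem_iUnion.2 ⟨k, ht₀, hxk⟩)
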